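/- Let $r>0$, $0<\alpha\le 0.2$ and $M>0$, and for each $n$ put $d=d(n)=\lfloor n^r\rfloor$. **Setting.** Let $(X_1,Y_1),\dots,(X_n,Y_n)$ be i.i.d. copies of a random pair $(X,Y)$ with values in $[0,1]^d\times[-M,M]$. A recursive partition $\Lambda$ of $[0,1]^d$ is obtained by starting from the node $[0,1]^d$ and repeatedly splitting a currently unsplit node $\nu$ into $\nu\cap\{x:x_j\le\tau\}$ and $\nu\cap\{x:x_j>\tau\}$ for some $j\in\{1,\dots,d\}$ and $\tau\in[0,1]$; the elements of $\Lambda$ are the nodes left unsplit at the end. The partition is $\{\alpha,k\}$-valid if it can be generated so that each child node contains at least a fraction $\alpha$ of the points $X_i$ lying in its parent node, and each terminal node contains at least $k$ of the points $X_i$; $\mathcal V_{\alpha,k}$ denotes the set of these partitions. Write $L(x)$ for the element of $\Lambda$ containing $x$, and let $$T_\Lambda(x)=\frac1{|\{i:X_i\in L(x)\}|}\sum_{i:\,X_i\in L(x)}Y_i,\qquad T^*_\Lambda(x)=\mathbb E\left[Y\mid X\in L(x)\right].$$ **Theorem.** There exist a constant $\zeta\ge1$, for each $n$ a distribution of $(X,Y)$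 on $[0,1]^{d(n)}\times[-M,M]$, and a sequence of integers $k=k(n)\ge1$ such that - for every $n$, $X$ has a density $f$ on $[0,1]^{d(n)}$ with $\zeta^{-1}\le f(x)\le\zeta$ for all $x$, and the coordinates of $X$ are independent; - for every $n$, $Y$ is independent of $X$ and $\mathbb P[Y=M]=\mathbb P[Y=-M]=1/2$; - $\displaystyle\lim_{n\to\infty}\frac{\log (n)\,\max\{\log (d),\,\log\log (n)\}}{k}=0$; and for which $$\lim_{n\to\infty}\mathbb P\left[\sup_{x\in[0,1]^d,\ \Lambda\in\mathcal V_{\alpha,k}}\left|T_\Lambda(x)-T^*_\Lambda(x)\right|\ \ge\ \frac M5\sqrt{\frac{\log (n)\,\log (d)}{k}}\,\right]=1.$$ -/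

import Mathlib

open MeasureTheory ProbabilityTheory Filter Topology
open scoped ENNReal

noncomputable section

/-- The feature space `[0,1]^d`. Its `volume` is Lebesgue measure on the unit cube. -/
abbrev Cube (d : ℕ) : Type := Fin d → unitInterval

/-- The child `ν ∩ {x : x_j ≤ τ}` of a node `ν`. -/
def childLeft {d : ℕ} (ν : Set (Cube d)) (j : Fin d) (τ : unitInterval) : Set (Cube d) :=
  ν ∩ {x | x j ≤ τ}

/-- The child `ν ∩ {x : x_j > τ}` of a node `ν`. -/
def childRight {d : ℕ} (ν : Set (Cube d)) (j : Fin d) (τ : unitInterval) : Set (Cube d) :=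
  ν ∩ {x | τ < x j}

/-- A recursive partitioning scheme: a node is either left unsplit (and is then terminal), or
split along variable `j` at threshold `τ`, whereupon both children are treated recursively. -/
inductive SplitScheme (d : ℕ) : Type
  | terminal : SplitScheme d
  | split (j : Fin d) (τ : unitInterval) (left right : SplitScheme d) : SplitScheme d

open scoped Classical in
/-- `#L`: the number of indices `i` with `X_i ∈ L`. -/
def pointCount {n d : ℕ} (X : Fin n → Cube d) (L : Set (Cube d)) : ℕ :=
  (Finset.univ.filter fun i => X i ∈ L).card

namespace SplitScheme

/-- The set of terminal nodes obtained by running the scheme from the node `ν`. -/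
def leaves {d : ℕ} : SplitScheme d → Set (Cube d) → Set (Set (Cube d))
  | terminal, ν => {ν}
  | split j τ l r, ν => leaves l (childLeft ν j τ) ∪ leaves r (childRight ν j τ)

/-- Run from the node `ν`, every child contains at least a fraction `α` of the data points of its
parent, and every terminal node contains at least `k` data points. -/
def Valid {n d : ℕ} (α : ℝ) (k : ℕ) (X : Fin n → Cube d) :
    SplitScheme d → Set (Cube d) → Prop
  | terminal, ν => k ≤ pointCount X ν
  | split j τ l r, ν =>
      α * (pointCount X ν : ℝ) ≤ (pointCount X (childLeft ν j τ) : ℝ) ∧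
      α * (pointCount X ν : ℝ) ≤ (pointCount X (childRight ν j τ) : ℝ) ∧
      Valid α k X l (childLeft ν j τ) ∧ Valid α k X r (childRight ν j τ)

theorem subset_of_mem_leaves {d : ℕ} (t : SplitScheme d) :
    ∀ (ν L : Set (Cube d)), L ∈ t.leaves ν → L ⊆ ν := by
  induction t with
  | terminal => intro ν L hL; exact (Set.mem_singleton_iff.1 hL).subset
  | split j τ l r ihl ihr =>
    intro ν L hL
    rcases hL with hL | hL
    · exact (ihl _ _ hL).trans Set.inter_subset_left
    · exact (ihr _ _ hL).trans Set.inter_subset_left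

/-- The terminal nodes do form a partition. -/
theorem existsUnique_leaf {d : ℕ} (t : SplitScheme d) :
    ∀ (ν : Set (Cube d)) (x : Cube d), x ∈ ν → ∃! L, L ∈ t.leaves ν ∧ x ∈ L := by
  induction t with
  | terminal => intro ν x hx; exact ⟨ν, ⟨rfl, hx⟩, fun L hL => hL.1⟩
  | split j τ l r ihl ihr =>
    intro ν x hx
    rcases le_or_gt (x j) τ with h | h
    · obtain ⟨L, hL, hu⟩ := ihl (childLeft ν j τ) x ⟨hx, h⟩
      refine ⟨L, ⟨Or.inl hL.1, hL.2⟩, ?_⟩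
      rintro L' ⟨h1 | h1, h2⟩
      · exact hu L' ⟨h1, h2⟩
      · exact absurd (subset_of_mem_leaves r _ _ h1 h2).2 (not_lt.2 h)
    · obtain ⟨L, hL, hu⟩ := ihr (childRight ν j τ) x ⟨hx, h⟩
      refine ⟨L, ⟨Or.inr hL.1, hL.2⟩, ?_⟩
      rintro L' ⟨h1 | h1, h2⟩
      · exact absurd (subset_of_mem_leaves l _ _ h1 h2).2 (not_le.2 h)
      · exact hu L' ⟨h1, h2⟩

end SplitScheme

/-- The set of `{α, k}`-valid partitions of `[0,1]^d` for the features `X`. -/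
def validPartitions {n d : ℕ} (α : ℝ) (k : ℕ) (X : Fin n → Cube d) :
    Set (Set (Set (Cube d))) :=
  {Λ | ∃ t : SplitScheme d, t.Valid α k X Set.univ ∧ Λ = t.leaves Set.univ}

/-- `L(x)`: the union of the elements of `Λ` that contain `x`. When `Λ` is a partition this is the
unique element of `Λ` containing `x`; see `cellOf_eq`. -/
def cellOf {d : ℕ} (Λ : Set (Set (Cube d))) (x : Cube d) : Set (Cube d) :=
  ⋃₀ {L | L ∈ Λ ∧ x ∈ L}

theorem cellOf_eq {n d : ℕ} {α : ℝ} {k : ℕ} {X : Fin n → Cube d} {Λ : Set (Set (Cube d))}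
    (hΛ : Λ ∈ validPartitions α k X) {L : Set (Cube d)} (hL : L ∈ Λ) {x : Cube d} (hx : x ∈ L) :
    cellOf Λ x = L := by
  obtain ⟨t, -, rfl⟩ := hΛ
  have hu := (t.existsUnique_leaf Set.univ x (Set.mem_univ x))
  have : {L' | L' ∈ t.leaves Set.univ ∧ x ∈ L'} = {L} := by
    ext L'
    exact ⟨fun h => hu.unique h ⟨hL, hx⟩, fun h => by
      rw [Set.mem_singleton_iff.1 h]; exact ⟨hL, hx⟩⟩
  rw [cellOf, this, Set.sUnion_singleton]

open scoped Classical in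
/-- The tree `T_Λ`: the average of the responses `Y_i` over the `i` with `X_i ∈ L(x)`. -/
def fittedTree {n d : ℕ} (D : Fin n → Cube d × ℝ) (Λ : Set (Set (Cube d))) (x : Cube d) : ℝ :=
  (∑ i ∈ Finset.univ.filter (fun i => (D i).1 ∈ cellOf Λ x), (D i).2) /
    (pointCount (fun i => (D i).1) (cellOf Λ x) : ℝ)

/-- The partition-optimal tree `T*_Λ(x) = E[Y | X ∈ L(x)]`, where `(X, Y)` has law `μ`. -/
def optimalTree {d : ℕ} (μ : Measure (Cube d × ℝ)) (Λ : Set (Set (Cube d))) (x : Cube d) : ℝ :=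
  ∫ p, p.2 ∂(μ[|Prod.fst ⁻¹' cellOf Λ x])

/-- The supremum of `|T_Λ(x) - T*_Λ(x)|` over `x ∈ [0,1]^d` and all `{α, k}`-valid `Λ`, as an
element of `[0, ∞]`. -/
def maxDeviation {n d : ℕ} (μ : Measure (Cube d × ℝ)) (α : ℝ) (k : ℕ)
    (D : Fin n → Cube d × ℝ) : ℝ≥0∞ :=
  ⨆ Λ ∈ validPartitions α k (fun i => (D i).1), ⨆ x : Cube d,
    ENNReal.ofReal |fittedTree D Λ x - optimalTree μ Λ x|

/-- The features have a density `f` on `[0,1]^d` with `ζ⁻¹ ≤ f ≤ ζ`. -/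
def WeaklyDependentFeatures {d : ℕ} (ζ : ℝ) (μ : Measure (Cube d × ℝ)) : Prop :=
  ∃ f : Cube d → ℝ, Measurable f ∧ (∀ x, ζ⁻¹ ≤ f x ∧ f x ≤ ζ) ∧
    μ.map Prod.fst = volume.withDensity (fun x => ENNReal.ofReal (f x))

/-- The minimum leaf size condition: `k(n) ≥ 1` and
`log n * max {log d, log log n} / k → 0` as `n → ∞`. -/
def MinimumLeafSize (d k : ℕ → ℕ) : Prop :=
  (∀ n, 1 ≤ k n) ∧
  Tendsto (fun n : ℕ => Real.log n * max (Real.log (d n)) (Real.log (Real.log n)) / (k n : ℝ))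
    atTop (𝓝 0)

end

/-! Take uniform features and independent signs `±M`, so that every optimal tree vanishes and the
leaf averages are pure noise. With `m = ⌊log n⌋`, halve the cube along `m` coordinates in turn,
always following the lower child. The final cell holds about `N = n / 2 ^ m` points, and `N ≥ n ^
0.3` because `log 2 < 0.7`. Drawing one coordinate from each of `m` blocks of size `b = ⌊d / m⌋`
gives `b ^ m` chains, whose logarithm is of order `Q = log n * log d`. The leaf sums `S_J` behave
like that many nearly independent variables of variance `N M²`, so the largest average should be of
order `M √(Q / N)`, with `k ≈ 0.9 N`.

Validity: a Chernoff bound with a union over all prefixes of all chains makes every cell count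
correct up to the factor `1 ± 1/40`, since `N` is a power of `n` while `Q` is `O(log² n)`
(`measure_pointCount_not_near`, `valid_chain`).

Size of the maximum: apply the second moment method to `Z = ∑ J, exp (c * S_J)`; only exponential
moments are needed, no lower tail estimates. Two chains correlate only through the intersection of
their cells, which is negligible unless they agree in most blocks, and few pairs do
(`sum_one_add_pow_le`). Hence `Z ≥ E Z / 2` with high probability (`measure_partitionFunction_lt`),
so some term is at least half its mean. Taking logarithms bounds that `S_J` from below
(`measure_maxDeviation_lt`). -/

noncomputable section

/-! ### Cylinders and chain-shaped trees -/

/-- The midpoint of the unit interval. -/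
def midpointI : unitInterval := ⟨1 / 2, by norm_num, by norm_num⟩

/-- The points of the cube whose coordinates in `s` are at most `1 / 2`. -/
def lowerCylinder {d : ℕ} (s : Finset (Fin d)) : Set (Cube d) := {x | ∀ j ∈ s, x j ≤ midpointI}

theorem lowerCylinder_empty {d : ℕ} : lowerCylinder (∅ : Finset (Fin d)) = Set.univ := by
  ext x; simp [lowerCylinder]

theorem lowerCylinder_inter {d : ℕ} (s t : Finset (Fin d)) :
    lowerCylinder s ∩ lowerCylinder t = lowerCylinder (s ∪ t) := by
  ext x
  simp only [lowerCylinder, Set.mem_inter_iff, Set.mem_ofPred_eq, Finset.mem_union]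
  exact ⟨fun h j hj => hj.elim (h.1 j) (h.2 j), fun h => ⟨fun j hj => h j (.inl hj),
    fun j hj => h j (.inr hj)⟩⟩

theorem childLeft_inter_lowerCylinder {d : ℕ} (ν : Set (Cube d)) (j : Fin d)
    (s : Finset (Fin d)) :
    childLeft ν j midpointI ∩ lowerCylinder s = ν ∩ lowerCylinder (insert j s) := by
  ext x
  simp [childLeft, lowerCylinder, and_assoc]

theorem measurableSet_lowerCylinder {d : ℕ} (s : Finset (Fin d)) :
    MeasurableSet (lowerCylinder s) := by
  have : lowerCylinder s = ⋂ j ∈ s, {x : Cube d | x j ≤ midpointI} := by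
    ext x; simp [lowerCylinder]
  rw [this]
  exact Finset.measurableSet_biInter _ fun j _ =>
    measurableSet_le (measurable_pi_apply j) measurable_const

theorem zero_mem_lowerCylinder {d : ℕ} (s : Finset (Fin d)) : (0 : Cube d) ∈ lowerCylinder s :=
  fun _ _ => unitInterval.nonneg'

theorem volume_lowerCylinder {d : ℕ} (s : Finset (Fin d)) :
    (volume : Measure (Cube d)).real (lowerCylinder s) = (1 / 2) ^ s.card := by
  classical
  have h : lowerCylinder s =
      Set.univ.pi fun j => if j ∈ s then Set.Iic midpointI else Set.univ := by
    ext x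
    simp only [lowerCylinder, Set.mem_ofPred_eq, Set.mem_pi, Set.mem_univ, forall_const]
    refine forall_congr' fun j => ?_
    by_cases hj : j ∈ s <;> simp [hj]
  rw [Measure.real, h, volume_pi_pi, ENNReal.toReal_prod]
  have : ∀ j, ((volume : Measure unitInterval)
      (if j ∈ s then Set.Iic midpointI else Set.univ)).toReal = if j ∈ s then 1 / 2 else 1 := by
    intro j
    by_cases hj : j ∈ s <;> simp [hj, midpointI]
  simp_rw [this]
  rw [Finset.prod_ite_mem]
  simp

theorem pointCount_childLeft_add_childRight {n d : ℕ} (X : Fin n → Cube d) (ν : Set (Cube d))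
    (j : Fin d) (τ : unitInterval) :
    pointCount X (childLeft ν j τ) + pointCount X (childRight ν j τ) = pointCount X ν := by
  classical
  unfold pointCount
  rw [← Finset.card_union_of_disjoint]
  · congr 1
    ext i
    simp only [Finset.mem_union, Finset.mem_filter, Finset.mem_univ, true_and, childLeft,
      childRight, Set.mem_inter_iff, Set.mem_ofPred_eq, ← and_or_left]
    exact and_iff_left (le_or_gt _ _)
  · rw [Finset.disjoint_filter]
    intro i _ h1 h2
    exact not_lt.2 (show X i j ≤ τ from h1.2) h2.2

namespace SplitScheme

/-- Split successively at `1 / 2` along the listed coordinates, following the lower child. -/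
def chain {d : ℕ} : List (Fin d) → SplitScheme d
  | [] => terminal
  | j :: js => split j midpointI (chain js) terminal

theorem mem_leaves_chain {d : ℕ} (js : List (Fin d)) :
    ∀ ν : Set (Cube d), ν ∩ lowerCylinder js.toFinset ∈ (chain js).leaves ν := by
  induction js with
  | nil => intro ν; simp [chain, leaves, lowerCylinder_empty]
  | cons j js ih =>
    intro ν
    rw [List.toFinset_cons, ← childLeft_inter_lowerCylinder]
    exact Or.inl (ih _)

/-- If the cell sizes along a chain are close to halving at each step, the chain is valid. -/
theorem valid_chain {n d : ℕ} {α : ℝ} (hα : α ≤ 0.2) {k : ℕ} {X : Fin n → Cube d}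
    (js : List (Fin d)) : ∀ (ν : Set (Cube d)) (A : ℝ), 0 ≤ A →
      (∀ i ≤ js.length,
        39 / 40 * (A / 2 ^ i) ≤ pointCount X (ν ∩ lowerCylinder (js.take i).toFinset) ∧
        pointCount X (ν ∩ lowerCylinder (js.take i).toFinset) ≤ 41 / 40 * (A / 2 ^ i)) →
      (k : ℝ) ≤ 37 / 40 * (A / 2 ^ js.length) → (chain js).Valid α k X ν := by
  induction js with
  | nil =>
    intro ν A hA h hk
    have h0 := (h 0 le_rfl).1
    simp only [List.take_nil, List.toFinset_nil, lowerCylinder_empty, Set.inter_univ, pow_zero,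
      div_one, List.length_nil] at h0 hk
    have : (k : ℝ) ≤ pointCount X ν := by linarith
    exact_mod_cast this
  | cons j js ih =>
    intro ν A hA h hk
    have h0 := h 0 (Nat.zero_le _)
    have h1 := h 1 (by simp)
    have hsum : (pointCount X (childLeft ν j midpointI) : ℝ) +
        pointCount X (childRight ν j midpointI) = pointCount X ν := by
      exact_mod_cast pointCount_childLeft_add_childRight X ν j midpointI
    simp only [List.take_zero, List.toFinset_nil, lowerCylinder_empty, Set.inter_univ, pow_zero,
      div_one] at h0
    simp only [List.take_succ_cons, List.take_zero, List.toFinset_cons,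
      ← childLeft_inter_lowerCylinder, pow_one, List.toFinset_nil, lowerCylinder_empty,
      Set.inter_univ] at h1
    have hα' : α * (pointCount X ν : ℝ) ≤ 0.2 * pointCount X ν :=
      mul_le_mul_of_nonneg_right hα (Nat.cast_nonneg _)
    norm_num at hα'
    -- The right child keeps at least `39/40 * A - 41/40 * (A / 2) = 37/40 * (A / 2)` points; this
    -- is the source of `37/40` in the bound on `k`.
    refine ⟨by linarith, by linarith, ih _ (A / 2) (by linarith) ?_ ?_, ?_⟩
    · intro i hi
      have := h (i + 1) (by simpa using hi)
      simpa only [List.take_succ_cons, List.toFinset_cons, ← childLeft_inter_lowerCylinder,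
        pow_succ', div_div] using this
    · simpa only [List.length_cons, pow_succ', div_div] using hk
    · have hle : A / 2 ^ (j :: js).length ≤ A / 2 := by
        refine div_le_div_of_nonneg_left hA two_pos ?_
        simpa [pow_succ] using one_le_pow₀ (M₀ := ℝ) one_le_two (n := js.length)
      have : (k : ℝ) ≤ pointCount X (childRight ν j midpointI) := by linarith
      exact_mod_cast this

end SplitScheme

/-! ### Uniform features with independent random signs -/

/-- The law of a random sign times `M`. -/
def signLaw (M : ℝ) : Measure ℝ := (2⁻¹ : ℝ≥0∞) • (Measure.dirac M + Measure.dirac (-M))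

/-- Uniform features on the cube and an independent random response `±M`. -/
def noiseLaw (d : ℕ) (M : ℝ) : Measure (Cube d × ℝ) :=
  (volume : Measure (Cube d)).prod (signLaw M)

instance (M : ℝ) : IsProbabilityMeasure (signLaw M) :=
  ⟨by simp [signLaw, ENNReal.inv_two_add_inv_two]⟩

instance (d : ℕ) (M : ℝ) : IsProbabilityMeasure (noiseLaw d M) := by
  unfold noiseLaw; infer_instance

theorem integrable_signLaw (M : ℝ) (h : ℝ → ℝ) : Integrable h (signLaw M) := by
  refine Integrable.smul_measure ?_ (by simp)
  exact (integrable_dirac (by simp)).add_measure (integrable_dirac (by simp))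

theorem integral_signLaw (M : ℝ) (h : ℝ → ℝ) :
    ∫ y, h y ∂signLaw M = (h M + h (-M)) / 2 := by
  rw [signLaw, integral_smul_measure, integral_add_measure (integrable_dirac (by simp))
    (integrable_dirac (by simp)), integral_dirac, integral_dirac]
  simp; ring

theorem integral_lowerCylinder_indicator_mul {d : ℕ} (M : ℝ) (s : Finset (Fin d)) (h : ℝ → ℝ) :
    Integrable (fun z : Cube d × ℝ => (lowerCylinder s).indicator 1 z.1 * h z.2) (noiseLaw d M) ∧
    ∫ z, (lowerCylinder s).indicator 1 z.1 * h z.2 ∂noiseLaw d M =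
      (1 / 2) ^ s.card * ((h M + h (-M)) / 2) := by
  have hI : Integrable ((lowerCylinder s).indicator (1 : Cube d → ℝ)) volume :=
    (integrable_const 1).indicator (measurableSet_lowerCylinder s)
  refine ⟨hI.mul_prod (integrable_signLaw M h), ?_⟩
  rw [noiseLaw, integral_prod_mul, integral_signLaw,
    integral_indicator_one (measurableSet_lowerCylinder s), volume_lowerCylinder]

theorem weaklyDependentFeatures_noiseLaw (d : ℕ) (M : ℝ) :
    WeaklyDependentFeatures 1 (noiseLaw d M) := by
  refine ⟨fun _ => 1, measurable_const, fun _ => by simp, ?_⟩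
  simp [noiseLaw, Measure.map_fst_prod]

theorem iIndepFun_coordinates_noiseLaw (d : ℕ) (M : ℝ) :
    iIndepFun (fun (j : Fin d) (p : Cube d × ℝ) => p.1 j) (noiseLaw d M) := by
  have h : iIndepFun (fun (j : Fin d) (x : Cube d) => x j) ((noiseLaw d M).map Prod.fst) := by
    have : (noiseLaw d M).map Prod.fst = Measure.pi fun _ : Fin d => volume := by
      simp [noiseLaw, Measure.map_fst_prod, volume_pi]
    rw [this]
    exact iIndepFun_pi (X := fun _ : Fin d => id) fun _ => aemeasurable_id
  rw [iIndepFun_iff_measure_inter_preimage_eq_mul] at h ⊢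
  intro S sets hsets
  have := h S hsets
  have hm : ∀ i ∈ S, MeasurableSet ((fun x : Cube d => x i) ⁻¹' sets i) :=
    fun i hi => measurable_pi_apply i (hsets i hi)
  rw [Measure.map_apply measurable_fst (Finset.measurableSet_biInter _ hm)] at this
  rw [Finset.prod_congr rfl fun i hi => Measure.map_apply measurable_fst (hm i hi)] at this
  rw [Set.preimage_iInter₂] at this
  exact this

theorem indepFun_noiseLaw (d : ℕ) (M : ℝ) :
    IndepFun (Prod.fst : Cube d × ℝ → Cube d) Prod.snd (noiseLaw d M) :=
  indepFun_prod measurable_id measurable_id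

theorem noiseLaw_snd_eq (d : ℕ) {M : ℝ} (hM : 0 < M) :
    noiseLaw d M {p | p.2 = M} = 1 / 2 ∧ noiseLaw d M {p | p.2 = -M} = 1 / 2 := by
  have h : ∀ c : ℝ, noiseLaw d M {p | p.2 = c} = signLaw M {c} := by
    intro c
    have : {p : Cube d × ℝ | p.2 = c} = Set.univ ×ˢ {c} := by ext; simp
    rw [this, noiseLaw, Measure.prod_prod]; simp
  rw [h, h]
  have h1 : -M ≠ M := by linarith
  constructor <;> simp [signLaw, h1, h1.symm]

/-- Conditioning on the features leaves a multiple of a product measure whose response factor has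
mean zero. The cell may be any set, even a null one. -/
theorem optimalTree_noiseLaw {d : ℕ} (M : ℝ) (Λ : Set (Set (Cube d))) (x : Cube d) :
    optimalTree (noiseLaw d M) Λ x = 0 := by
  have h : (Prod.fst ⁻¹' cellOf Λ x : Set (Cube d × ℝ)) = cellOf Λ x ×ˢ Set.univ := by ext; simp
  rw [optimalTree, ProbabilityTheory.cond, integral_smul_measure, h, noiseLaw,
    ← Measure.prod_restrict, Measure.restrict_univ, integral_fun_snd (f := fun y : ℝ => y),
    integral_signLaw]
  simp

/-! ### Concentration of cell counts -/

theorem pointCount_eq_sum_indicator {n d : ℕ} (X : Fin n → Cube d) (L : Set (Cube d)) :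
    (pointCount X L : ℝ) = ∑ i, L.indicator 1 (X i) := by
  classical
  simp [pointCount, Set.indicator_apply]

theorem integrable_pi_prod {n : ℕ} {Ω : Type*} [MeasurableSpace Ω] {μ : Measure Ω} [SigmaFinite μ]
    {g : Ω → ℝ} (hg : Integrable g μ) :
    Integrable (fun D : Fin n → Ω => ∏ i, g (D i)) (Measure.pi fun _ => μ) :=
  Integrable.fintype_prod (f := fun _ => g) fun _ => hg

theorem measure_le_ofReal_of_exp_le {Ω : Type*} [MeasurableSpace Ω] {P : Measure Ω}
    [IsFiniteMeasure P] {W : Ω → ℝ} (hW : Integrable (fun ω => Real.exp (W ω)) P) (t : ℝ) :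
    P {ω | t ≤ W ω} ≤ ENNReal.ofReal (Real.exp (-t) * ∫ ω, Real.exp (W ω) ∂P) := by
  have h := mul_meas_ge_le_integral_of_nonneg (ae_of_all P fun ω => (Real.exp_pos (W ω)).le) hW
    (Real.exp t)
  simp only [Real.exp_le_exp] at h
  rw [← ofReal_measureReal]
  refine ENNReal.ofReal_le_ofReal ?_
  rw [Real.exp_neg, inv_mul_eq_div, le_div_iff₀' (Real.exp_pos _)]
  exact h

theorem exp_sub_one_le_add_sq {u : ℝ} (hu : |u| ≤ 1) : Real.exp u - 1 ≤ u + u ^ 2 := by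
  have := (abs_le.1 (Real.abs_exp_sub_one_sub_id_le hu)).2
  linarith

/-- Chernoff's bound; the sign of `u` selects the upper or the lower tail. -/
theorem measure_pointCount_tail {n d : ℕ} (M : ℝ) (s : Finset (Fin d)) {u : ℝ} (hu : |u| ≤ 1)
    (θ : ℝ) :
    Measure.pi (fun _ : Fin n => noiseLaw d M)
        {D | u * θ ≤ u * pointCount (fun i => (D i).1) (lowerCylinder s)} ≤
      ENNReal.ofReal (Real.exp (n * (1 / 2) ^ s.card * (u + u ^ 2) - u * θ)) := by
  let g : Cube d × ℝ → ℝ := fun z =>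
    1 + (lowerCylinder s).indicator 1 z.1 * (fun _ : ℝ => Real.exp u - 1) z.2
  have hg := integral_lowerCylinder_indicator_mul M s fun _ => Real.exp u - 1
  have hgI : Integrable g (noiseLaw d M) := (integrable_const 1).add hg.1
  have hgint : ∫ z, g z ∂noiseLaw d M = 1 + (1 / 2) ^ s.card * (Real.exp u - 1) := by
    rw [integral_add (integrable_const 1) hg.1, hg.2]
    simp
  have hexp : ∀ D : Fin n → Cube d × ℝ,
      Real.exp (u * pointCount (fun i => (D i).1) (lowerCylinder s)) = ∏ i, g (D i) := by
    intro D
    rw [pointCount_eq_sum_indicator, Finset.mul_sum, Real.exp_sum]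
    refine Finset.prod_congr rfl fun i _ => ?_
    by_cases hi : (D i).1 ∈ lowerCylinder s <;> simp [g, hi]
  refine (measure_le_ofReal_of_exp_le ?_ _).trans (ENNReal.ofReal_le_ofReal ?_)
  · simp_rw [hexp]
    exact integrable_pi_prod hgI
  · simp_rw [hexp]
    rw [integral_fintype_prod_eq_pow, hgint, Fintype.card_fin,
      sub_eq_neg_add (_ * _), Real.exp_add]
    refine mul_le_mul_of_nonneg_left ?_ (Real.exp_pos _).le
    rw [mul_assoc, Real.exp_nat_mul]
    have hq : (0 : ℝ) ≤ (1 / 2) ^ s.card := by positivity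
    have hq1 : ((1 : ℝ) / 2) ^ s.card ≤ 1 := pow_le_one₀ (by norm_num) (by norm_num)
    have := mul_le_mul_of_nonneg_left (exp_sub_one_le_add_sq hu) hq
    have h0 := Real.add_one_le_exp ((1 / 2) ^ s.card * (u + u ^ 2))
    refine pow_le_pow_left₀ ?_ (by linarith) n
    nlinarith [Real.exp_pos u, mul_nonneg hq (Real.exp_pos u).le]

theorem measure_pointCount_not_near {n d : ℕ} (M : ℝ) (s : Finset (Fin d)) :
    Measure.pi (fun _ : Fin n => noiseLaw d M)
        {D | ¬ (39 / 40 * (n / 2 ^ s.card : ℝ) ≤ pointCount (fun i => (D i).1) (lowerCylinder s) ∧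
          pointCount (fun i => (D i).1) (lowerCylinder s) ≤ 41 / 40 * (n / 2 ^ s.card : ℝ))} ≤
      ENNReal.ofReal (2 * Real.exp (-(n / 2 ^ s.card / 6400))) := by
  -- The values `u = ±1/80` minimise `u ^ 2 - |u| / 40`, with minimum `-1/6400`.
  have h1 := measure_pointCount_tail (n := n) M s (u := 1 / 80)
    (by rw [abs_le]; constructor <;> norm_num) (41 / 40 * (n / 2 ^ s.card))
  have h2 := measure_pointCount_tail (n := n) M s (u := -(1 / 80))
    (by rw [abs_le]; constructor <;> norm_num) (39 / 40 * (n / 2 ^ s.card))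
  have e1 : n * (1 / 2) ^ s.card * (1 / 80 + (1 / 80) ^ 2) - 1 / 80 * (41 / 40 * (n / 2 ^ s.card))
      = -((n : ℝ) / 2 ^ s.card / 6400) := by
    rw [one_div_pow]; ring
  have e2 : n * (1 / 2) ^ s.card * (-(1 / 80) + (-(1 / 80)) ^ 2)
      - -(1 / 80) * (39 / 40 * (n / 2 ^ s.card)) = -((n : ℝ) / 2 ^ s.card / 6400) := by
    rw [one_div_pow]; ring
  rw [e1] at h1
  rw [e2] at h2
  rw [two_mul, ENNReal.ofReal_add (Real.exp_pos _).le (Real.exp_pos _).le]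
  refine (measure_mono ?_).trans ((measure_union_le _ _).trans (add_le_add h1 h2))
  intro D hD
  rcases not_and_or.1 hD with h | h
  · right
    rw [Set.mem_ofPred_eq]
    linarith
  · left
    rw [Set.mem_ofPred_eq]
    linarith

/-! ### Exponential moments of the leaf sums -/

/-- The factor `exp (c y)` on the cylinder of `s`, and `1` off it. -/
def tilt {d : ℕ} (c : ℝ) (s : Finset (Fin d)) (z : Cube d × ℝ) : ℝ :=
  1 + (lowerCylinder s).indicator 1 z.1 * (Real.exp (c * z.2) - 1)

theorem tilt_eq_exp {d : ℕ} (c : ℝ) (s : Finset (Fin d)) (z : Cube d × ℝ) :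
    tilt c s z = Real.exp (c * ((lowerCylinder s).indicator 1 z.1 * z.2)) := by
  by_cases h : z.1 ∈ lowerCylinder s <;> simp [tilt, h]

theorem integrable_tilt {d : ℕ} (M c : ℝ) (s : Finset (Fin d)) :
    Integrable (tilt c s) (noiseLaw d M) :=
  (integrable_const 1).add
    (integral_lowerCylinder_indicator_mul M s fun y => Real.exp (c * y) - 1).1

theorem integral_tilt {d : ℕ} (M c : ℝ) (s : Finset (Fin d)) :
    ∫ z, tilt c s z ∂noiseLaw d M = 1 + (1 / 2) ^ s.card * (Real.cosh (c * M) - 1) := by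
  have h := integral_lowerCylinder_indicator_mul M s fun y => Real.exp (c * y) - 1
  simp only [tilt]
  rw [integral_add (integrable_const 1) h.1, h.2, Real.cosh_eq]
  simp
  ring

theorem tilt_mul_tilt {d : ℕ} (c : ℝ) (s t : Finset (Fin d)) (z : Cube d × ℝ) :
    tilt c s z * tilt c t z = tilt c s z + (tilt c t z - 1) +
      (lowerCylinder (s ∪ t)).indicator 1 z.1 * (Real.exp (c * z.2) - 1) ^ 2 := by
  rw [← lowerCylinder_inter, Set.inter_indicator_one]
  simp only [tilt, Pi.mul_apply]
  ring

theorem integrable_tilt_mul_tilt {d : ℕ} (M c : ℝ) (s t : Finset (Fin d)) :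
    Integrable (fun z => tilt c s z * tilt c t z) (noiseLaw d M) := by
  simp_rw [tilt_mul_tilt]
  exact ((integrable_tilt M c s).add ((integrable_tilt M c t).sub (integrable_const 1))).add
    (integral_lowerCylinder_indicator_mul M _ fun y => (Real.exp (c * y) - 1) ^ 2).1

/-- With `a = cosh (c * M) - 1`, the square of `exp (c * y) - 1` has mean `2 * a * (1 + a)`; it is
weighted by the volume of the intersection of the two cylinders. -/
theorem integral_tilt_mul_tilt {d : ℕ} (M c : ℝ) (s t : Finset (Fin d)) :
    ∫ z, tilt c s z * tilt c t z ∂noiseLaw d M =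
      1 + (1 / 2) ^ s.card * (Real.cosh (c * M) - 1) + (1 / 2) ^ t.card * (Real.cosh (c * M) - 1) +
        (1 / 2) ^ (s ∪ t).card *
          (2 * (Real.cosh (c * M) - 1) * (1 + (Real.cosh (c * M) - 1))) := by
  have h := integral_lowerCylinder_indicator_mul M (s ∪ t) fun y => (Real.exp (c * y) - 1) ^ 2
  have h2 : Integrable (fun z => tilt c t z - 1) (noiseLaw d M) :=
    (integrable_tilt M c t).sub (integrable_const 1)
  have h3 : Integrable (fun z => tilt c s z + (tilt c t z - 1)) (noiseLaw d M) :=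
    (integrable_tilt M c s).add h2
  simp_rw [tilt_mul_tilt]
  rw [integral_add h3 h.1, h.2, integral_add (integrable_tilt M c s) h2,
    integral_sub (integrable_tilt M c t) (integrable_const 1), integral_tilt, integral_tilt]
  have hm : Real.exp (c * M) * Real.exp (-(c * M)) = 1 := by rw [← Real.exp_add]; simp
  rw [Real.cosh_eq]
  simp only [integral_const, probReal_univ, smul_eq_mul, mul_one, mul_neg]
  linear_combination (-((1 / 2 : ℝ) ^ (s ∪ t).card)) * hm

theorem integral_tilt_mul_tilt_le {d m : ℕ} (M c : ℝ) {s t : Finset (Fin d)} (hs : s.card = m)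
    (ht : t.card = m) :
    ∫ z, tilt c s z * tilt c t z ∂noiseLaw d M ≤
      (1 + (1 / 2) ^ m * (Real.cosh (c * M) - 1)) ^ 2 * (1 + (1 / 2) ^ (s ∪ t).card *
          (2 * (Real.cosh (c * M) - 1) * (1 + (Real.cosh (c * M) - 1)))) := by
  rw [integral_tilt_mul_tilt, hs, ht]
  have ha : 0 ≤ Real.cosh (c * M) - 1 := sub_nonneg.2 (Real.one_le_cosh _)
  set a := Real.cosh (c * M) - 1
  have hg : 0 ≤ (1 / 2 : ℝ) ^ (s ∪ t).card * (2 * a * (1 + a)) := by positivity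
  have hp : 0 ≤ (1 / 2 : ℝ) ^ m * a := by positivity
  set G := (1 / 2 : ℝ) ^ (s ∪ t).card * (2 * a * (1 + a))
  set x := (1 / 2 : ℝ) ^ m * a
  nlinarith [mul_nonneg hp hg, mul_nonneg (mul_nonneg hp hp) hg]

/-- Chebyshev's inequality, with variance at most `B - 1`. -/
theorem measure_lt_half_of_integral_eq_one {Ω : Type*} [MeasurableSpace Ω] {P : Measure Ω}
    [IsProbabilityMeasure P] {Z : Ω → ℝ} (hZ : Integrable Z P)
    (hZ2 : Integrable (fun ω => Z ω ^ 2) P) (h1 : ∫ ω, Z ω ∂P = 1) {B : ℝ}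
    (hB : ∫ ω, Z ω ^ 2 ∂P ≤ B) :
    P {ω | Z ω < 1 / 2} ≤ ENNReal.ofReal (4 * (B - 1)) := by
  have hexp : ∀ ω, (Z ω - 1) ^ 2 = Z ω ^ 2 - 2 * Z ω + 1 := fun ω => by ring
  have hI0 : Integrable (fun ω => Z ω ^ 2 - 2 * Z ω) P := hZ2.sub (hZ.const_mul 2)
  have hI : Integrable (fun ω => (Z ω - 1) ^ 2) P := by
    simp_rw [hexp]
    exact hI0.add (integrable_const 1)
  have hint : ∫ ω, (Z ω - 1) ^ 2 ∂P = ∫ ω, Z ω ^ 2 ∂P - 1 := by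
    simp_rw [hexp]
    rw [integral_add hI0 (integrable_const 1), integral_sub hZ2 (hZ.const_mul 2),
      integral_const_mul, h1]
    simp
    ring
  have h := mul_meas_ge_le_integral_of_nonneg (ae_of_all P fun ω => sq_nonneg (Z ω - 1)) hI (1 / 4)
  refine (measure_mono (t := {ω | 1 / 4 ≤ (Z ω - 1) ^ 2}) fun ω hω => ?_).trans ?_
  · rw [Set.mem_ofPred_eq] at hω ⊢
    nlinarith
  · rw [← ofReal_measureReal]
    exact ENNReal.ofReal_le_ofReal (by linarith)

/-- The sum over a family of cylinders of the exponentials of `c` times the response sum. -/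
def partitionFunction {n d : ℕ} {ι : Type*} [Fintype ι] (c : ℝ) (s : ι → Finset (Fin d))
    (D : Fin n → Cube d × ℝ) : ℝ :=
  ∑ J, ∏ i, tilt c (s J) (D i)

/-- Chebyshev for the normalised sum. Independence over the sample turns each pair of terms into an
`n`-th power, and `hB` bounds the mean correlation factor over pairs. -/
theorem measure_partitionFunction_lt {n d m : ℕ} {ι : Type*} [Fintype ι] [Nonempty ι] (M c : ℝ)
    (s : ι → Finset (Fin d)) (hs : ∀ J, (s J).card = m) {B : ℝ}
    (hB : ∑ J, ∑ J', (1 + (1 / 2 : ℝ) ^ (s J ∪ s J').card *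
        (2 * (Real.cosh (c * M) - 1) * (1 + (Real.cosh (c * M) - 1)))) ^ n ≤
      (Fintype.card ι : ℝ) ^ 2 * B) :
    Measure.pi (fun _ : Fin n => noiseLaw d M)
        {D | partitionFunction c s D <
          Fintype.card ι * (1 + (1 / 2) ^ m * (Real.cosh (c * M) - 1)) ^ n / 2} ≤
      ENNReal.ofReal (4 * (B - 1)) := by
  set P := Measure.pi (fun _ : Fin n => noiseLaw d M)
  have ha : 0 ≤ Real.cosh (c * M) - 1 := sub_nonneg.2 (Real.one_le_cosh _)
  set A := (1 + (1 / 2 : ℝ) ^ m * (Real.cosh (c * M) - 1)) with hA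
  have hApos : 0 < A := by positivity
  have hK : (0 : ℝ) < Fintype.card ι := by exact_mod_cast Fintype.card_pos
  have hKA : 0 < Fintype.card ι * A ^ n := by positivity
  have hI : ∀ J, Integrable (fun D : Fin n → Cube d × ℝ => ∏ i, tilt c (s J) (D i)) P :=
    fun J => integrable_pi_prod (integrable_tilt M c (s J))
  have hI2 : ∀ J J', Integrable
      (fun D : Fin n → Cube d × ℝ => ∏ i, tilt c (s J) (D i) * tilt c (s J') (D i)) P :=
    fun J J' => integrable_pi_prod (integrable_tilt_mul_tilt M c (s J) (s J'))
  have hV : Integrable (partitionFunction (n := n) c s) P := integrable_finsetSum _ fun J _ => hI J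
  have hVint : ∫ D, partitionFunction c s D ∂P = Fintype.card ι * A ^ n := by
    simp only [partitionFunction]
    rw [integral_finsetSum _ fun J _ => hI J]
    simp_rw [P, integral_fintype_prod_eq_pow, integral_tilt, hs, Fintype.card_fin]
    simp [hA]
  have hsq : ∀ D : Fin n → Cube d × ℝ, partitionFunction c s D ^ 2 =
      ∑ J, ∑ J', ∏ i, tilt c (s J) (D i) * tilt c (s J') (D i) := by
    intro D
    simp only [partitionFunction, sq, Finset.sum_mul_sum, Finset.prod_mul_distrib]
  have hV2 : Integrable (fun D => partitionFunction (n := n) c s D ^ 2) P := by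
    simp_rw [hsq]
    exact integrable_finsetSum _ fun J _ => integrable_finsetSum _ fun J' _ => hI2 J J'
  have hV2int : ∫ D, partitionFunction c s D ^ 2 ∂P ≤ (Fintype.card ι * A ^ n) ^ 2 * B := by
    simp_rw [hsq]
    rw [integral_finsetSum _ fun J _ => integrable_finsetSum _ fun J' _ => hI2 J J']
    have : ∀ J, ∫ D, ∑ J', ∏ i, tilt c (s J) (D i) * tilt c (s J') (D i) ∂P ≤
        (A ^ n) ^ 2 * ∑ J', (1 + (1 / 2 : ℝ) ^ (s J ∪ s J').card *
        (2 * (Real.cosh (c * M) - 1) * (1 + (Real.cosh (c * M) - 1)))) ^ n := by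
      intro J
      rw [integral_finsetSum _ fun J' _ => hI2 J J', Finset.mul_sum]
      refine Finset.sum_le_sum fun J' _ => ?_
      rw [integral_fintype_prod_eq_pow (fun z => tilt c (s J) z * tilt c (s J') z),
        Fintype.card_fin, ← pow_mul, mul_comm n 2, pow_mul, ← mul_pow]
      refine pow_le_pow_left₀ (integral_nonneg fun z => ?_)
        (integral_tilt_mul_tilt_le M c (hs J) (hs J')) n
      simp only [Pi.zero_apply, tilt_eq_exp]
      positivity
    refine (Finset.sum_le_sum fun J _ => this J).trans ?_
    have e : (Fintype.card ι * A ^ n) ^ 2 * B = (A ^ n) ^ 2 * ((Fintype.card ι : ℝ) ^ 2 * B) := by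
      ring
    rw [← Finset.mul_sum, e]
    exact mul_le_mul_of_nonneg_left hB (sq_nonneg _)
  have key := measure_lt_half_of_integral_eq_one (P := P)
    (Z := fun D => (Fintype.card ι * A ^ n)⁻¹ * partitionFunction c s D) (hV.const_mul _)
    (by simp_rw [mul_pow ((Fintype.card ι * A ^ n)⁻¹)]; exact hV2.const_mul _)
    (by rw [integral_const_mul, hVint, inv_mul_cancel₀ hKA.ne'])
    (B := B) (by
      simp_rw [mul_pow ((Fintype.card ι * A ^ n)⁻¹)]
      rw [integral_const_mul, inv_pow, inv_mul_le_iff₀ (by positivity)]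
      exact hV2int)
  refine (measure_mono fun D hD => ?_).trans key
  rw [Set.mem_ofPred_eq] at hD ⊢
  rw [inv_mul_lt_iff₀ hKA]
  linarith

/-! ### A large family of split sequences -/

/-- Coordinate number `p.2` in block number `p.1`. -/
def blockCoordinate {m b d : ℕ} (h : m * b ≤ d) (p : Fin m × Fin b) : Fin d :=
  Fin.castLE h (finProdFinEquiv p)

theorem blockCoordinate_injective {m b d : ℕ} (h : m * b ≤ d) :
    Function.Injective (blockCoordinate h) :=
  (Fin.castLE_injective h).comp finProdFinEquiv.injective

/-- The sequence of coordinates that picks number `J i` from block `i`. -/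
def splitSequence {m b d : ℕ} (h : m * b ≤ d) (J : Fin m → Fin b) : List (Fin d) :=
  List.ofFn fun i => blockCoordinate h (i, J i)

theorem nodup_splitSequence {m b d : ℕ} (h : m * b ≤ d) (J : Fin m → Fin b) :
    (splitSequence h J).Nodup :=
  List.nodup_ofFn.2 fun _ _ hij => congrArg Prod.fst (blockCoordinate_injective h hij)

theorem length_splitSequence {m b d : ℕ} (h : m * b ≤ d) (J : Fin m → Fin b) :
    (splitSequence h J).length = m := List.length_ofFn

theorem card_take_splitSequence {m b d : ℕ} (h : m * b ≤ d) (J : Fin m → Fin b) {i : ℕ}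
    (hi : i ≤ m) : ((splitSequence h J).take i).toFinset.card = i := by
  rw [List.toFinset_card_of_nodup ((nodup_splitSequence h J).sublist (List.take_sublist _ _)),
    List.length_take, length_splitSequence, min_eq_left hi]

theorem card_splitSequence {m b d : ℕ} (h : m * b ≤ d) (J : Fin m → Fin b) :
    (splitSequence h J).toFinset.card = m := by
  rw [List.toFinset_card_of_nodup (nodup_splitSequence h J), length_splitSequence]

/-- The number of blocks where two choices agree. -/
def agreement {m b : ℕ} (J J' : Fin m → Fin b) : ℕ := (Finset.univ.filter fun i => J i = J' i).card

theorem agreement_le {m b : ℕ} (J J' : Fin m → Fin b) : agreement J J' ≤ m := by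
  simpa [agreement] using Finset.card_filter_le (Finset.univ : Finset (Fin m)) fun i => J i = J' i

/-- Blocks are disjoint, so two sequences share a coordinate only where they agree in a block; the
rest is inclusion-exclusion. -/
theorem card_union_add_agreement {m b d : ℕ} (h : m * b ≤ d) (J J' : Fin m → Fin b) :
    ((splitSequence h J).toFinset ∪ (splitSequence h J').toFinset).card + agreement J J' =
      2 * m := by
  have hinter : agreement J J' =
      ((splitSequence h J).toFinset ∩ (splitSequence h J').toFinset).card := by
    have : (splitSequence h J).toFinset ∩ (splitSequence h J').toFinset =
        (Finset.univ.filter fun i => J i = J' i).image fun i => blockCoordinate h (i, J i) := by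
      ext x
      simp only [Finset.mem_inter, List.mem_toFinset, splitSequence, List.mem_ofFn',
        Set.mem_range, Finset.mem_image, Finset.mem_filter, Finset.mem_univ, true_and]
      constructor
      · rintro ⟨⟨i, rfl⟩, i', hi'⟩
        have := blockCoordinate_injective h hi'
        obtain ⟨rfl, h2⟩ := Prod.mk.inj this
        exact ⟨i', h2.symm, rfl⟩
      · rintro ⟨i, hi, rfl⟩
        exact ⟨⟨i, rfl⟩, i, by rw [hi]⟩
    rw [this, Finset.card_image_of_injective _ fun _ _ hij =>
      congrArg Prod.fst (blockCoordinate_injective h hij), agreement]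
  rw [hinter, Finset.card_union_add_card_inter, card_splitSequence, card_splitSequence, two_mul]

/-- The sum factorises over blocks, and each block contributes `b + (b - 1) ≤ 2 * b`. This is the
moment used to show that large agreement is rare. -/
theorem sum_pow_agreement_le {m b : ℕ} (J : Fin m → Fin b) :
    ∑ J' : Fin m → Fin b, (b : ℝ) ^ agreement J J' ≤ (2 * b) ^ m := by
  have h : ∀ J' : Fin m → Fin b,
      (b : ℝ) ^ agreement J J' = ∏ i, if J i = J' i then (b : ℝ) else 1 := by
    intro J'
    rw [Finset.prod_ite]
    simp [agreement]
  simp_rw [h]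
  have hprod := Finset.prod_univ_sum (fun _ : Fin m => (Finset.univ : Finset (Fin b)))
    fun i j => if J i = j then (b : ℝ) else 1
  rw [Fintype.piFinset_univ] at hprod
  rw [← hprod]
  refine (Finset.prod_le_prod (g := fun _ => 2 * (b : ℝ)) (fun i _ => ?_) fun i _ => ?_).trans_eq
    (by simp)
  · exact Finset.sum_nonneg fun j _ => by split_ifs <;> positivity
  have : ∀ j, (if J i = j then (b : ℝ) else 1) ≤ (if J i = j then (b : ℝ) else 0) + 1 := by
    intro j
    split_ifs <;> simp
  refine (Finset.sum_le_sum fun j _ => this j).trans_eq ?_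
  rw [Finset.sum_add_distrib]
  simp [two_mul]

theorem sum_one_add_pow_le {n m b d : ℕ} (h : m * b ≤ d) (hb : 0 < b) {g : ℝ} (hg : 0 ≤ g)
    (J : Fin m → Fin b) :
    ∑ J' : Fin m → Fin b, (1 + (1 / 2 : ℝ) ^
        ((splitSequence h J).toFinset ∪ (splitSequence h J').toFinset).card * g) ^ n ≤
      (b : ℝ) ^ m * (Real.exp (n * g / 2 ^ m * Real.exp (-(m / 4 * Real.log 2))) +
        Real.exp (n * g / 2 ^ m + m * Real.log 2 - 3 / 4 * m * Real.log b)) := by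
  set β : ℝ := n * g / 2 ^ m with hβ
  have hβ0 : 0 ≤ β := by positivity
  have hb' : (1 : ℝ) ≤ b := by exact_mod_cast hb
  have hb0 : (0 : ℝ) < b := by linarith
  have hl2 : 0 < Real.log 2 := Real.log_pos one_lt_two
  have hlb : 0 ≤ Real.log b := Real.log_nonneg hb'
  have hpowb : ∀ s : ℕ, (b : ℝ) ^ s = Real.exp (s * Real.log b) := fun s => by
    rw [Real.exp_nat_mul, Real.exp_log hb0]
  have hpow2 : ∀ s : ℕ, (2 : ℝ) ^ s = Real.exp (s * Real.log 2) := fun s => by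
    rw [Real.exp_nat_mul, Real.exp_log two_pos]
  have hterm : ∀ J' : Fin m → Fin b, (1 + (1 / 2 : ℝ) ^
        ((splitSequence h J).toFinset ∪ (splitSequence h J').toFinset).card * g) ^ n ≤
      Real.exp (β * Real.exp (-(m / 4 * Real.log 2))) +
        Real.exp (β - 3 / 4 * m * Real.log b) * (b : ℝ) ^ agreement J J' := by
    intro J'
    have hcard := card_union_add_agreement h J J'
    have hle := agreement_le J J'
    set s := agreement J J'
    have hle' : (s : ℝ) ≤ m := by exact_mod_cast hle
    have hx : (n : ℝ) * ((1 / 2 : ℝ) ^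
        ((splitSequence h J).toFinset ∪ (splitSequence h J').toFinset).card * g) =
        β * Real.exp (-((m - s) * Real.log 2)) := by
      have : (1 / 2 : ℝ) ^ ((splitSequence h J).toFinset ∪ (splitSequence h J').toFinset).card =
          (2 ^ m)⁻¹ * Real.exp (-((m - s) * Real.log 2)) := by
        have e : ((m : ℝ) - s) = ((m - s : ℕ) : ℝ) := by rw [Nat.cast_sub hle]
        rw [e, Real.exp_neg, ← hpow2, one_div_pow, one_div, ← mul_inv, ← pow_add]
        congr 2
        omega
      rw [this, hβ]
      field_simp
    have h1 : (1 + (1 / 2 : ℝ) ^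
        ((splitSequence h J).toFinset ∪ (splitSequence h J').toFinset).card * g) ^ n ≤
        Real.exp (β * Real.exp (-((m - s) * Real.log 2))) := by
      rw [← hx, Real.exp_nat_mul]
      refine pow_le_pow_left₀ (by positivity) ?_ n
      rw [add_comm]
      exact Real.add_one_le_exp _
    refine h1.trans ?_
    rw [hpowb, ← Real.exp_add]
    -- Below `3m/4` agreements the overlap factor is at most `2 ^ (-m/4)`. Above, Markov's
    -- inequality for `b ^ s` pays for the trivial bound `exp β`.
    rcases lt_or_ge (4 * (s : ℝ)) (3 * m) with hs | hs
    · refine le_add_of_le_of_nonneg ?_ (Real.exp_pos _).le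
      gcongr
      linarith
    · refine le_add_of_nonneg_of_le (Real.exp_pos _).le ?_
      rw [Real.exp_le_exp]
      have h2 : Real.exp (-((m - s) * Real.log 2)) ≤ 1 := by
        rw [Real.exp_le_one_iff, neg_nonpos]
        exact mul_nonneg (by linarith) hl2.le
      have h3 := mul_le_mul_of_nonneg_left h2 hβ0
      have h4 : 3 / 4 * m * Real.log b ≤ s * Real.log b :=
        mul_le_mul_of_nonneg_right (by linarith) hlb
      linarith
  refine (Finset.sum_le_sum fun J' _ => hterm J').trans ?_
  rw [Finset.sum_add_distrib, ← Finset.mul_sum, mul_add]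
  refine add_le_add (by simp) ?_
  refine (mul_le_mul_of_nonneg_left (sum_pow_agreement_le J) (Real.exp_pos _).le).trans_eq ?_
  rw [mul_pow, hpow2, hpowb, ← Real.exp_add, ← Real.exp_add, ← Real.exp_add]
  congr 1
  ring

/-! ### The deviation bound for a fixed sample size -/

theorem le_maxDeviation {n d : ℕ} {M α : ℝ} (hα : α ≤ 0.2) {k : ℕ} {D : Fin n → Cube d × ℝ}
    {js : List (Fin d)}
    (hnear : ∀ i ≤ js.length,
      39 / 40 * ((n : ℝ) / 2 ^ i) ≤
        pointCount (fun i => (D i).1) (lowerCylinder (js.take i).toFinset) ∧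
      pointCount (fun i => (D i).1) (lowerCylinder (js.take i).toFinset) ≤
        41 / 40 * ((n : ℝ) / 2 ^ i))
    (hk : (k : ℝ) ≤ 37 / 40 * ((n : ℝ) / 2 ^ js.length)) (hn : 0 < n) {t : ℝ} (ht : 0 ≤ t)
    (hsum : t * (41 / 40 * ((n : ℝ) / 2 ^ js.length)) ≤
      ∑ i, (lowerCylinder js.toFinset).indicator 1 (D i).1 * (D i).2) :
    ENNReal.ofReal t ≤ maxDeviation (noiseLaw d M) α k D := by
  classical
  have hvalid : (SplitScheme.chain js).Valid α k (fun i => (D i).1) Set.univ :=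
    SplitScheme.valid_chain hα js Set.univ n (Nat.cast_nonneg n)
      (by simpa only [Set.univ_inter] using hnear) hk
  have hΛ : (SplitScheme.chain js).leaves Set.univ ∈ validPartitions α k fun i => (D i).1 :=
    ⟨_, hvalid, rfl⟩
  have hleaf := SplitScheme.mem_leaves_chain js Set.univ
  rw [Set.univ_inter] at hleaf
  have hcell := cellOf_eq hΛ hleaf (zero_mem_lowerCylinder js.toFinset)
  obtain ⟨hlo, hhi⟩ := hnear js.length le_rfl
  rw [List.take_length] at hlo hhi
  have hpos : (0 : ℝ) < pointCount (fun i => (D i).1) (lowerCylinder js.toFinset) := by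
    have : (0 : ℝ) < (n : ℝ) / 2 ^ js.length := by positivity
    linarith
  unfold maxDeviation
  -- The origin lies in every lower cylinder, so it serves as the evaluation point for every chain.
  refine le_iSup₂_of_le _ hΛ (le_iSup_of_le 0 (ENNReal.ofReal_le_ofReal ?_))
  rw [optimalTree_noiseLaw, sub_zero]
  refine le_trans ?_ (le_abs_self _)
  rw [fittedTree, hcell, le_div_iff₀ hpos]
  refine (mul_le_mul_of_nonneg_left hhi ht).trans (hsum.trans_eq ?_)
  rw [Finset.sum_filter]
  refine Finset.sum_congr rfl fun i _ => ?_
  by_cases hi : (D i).1 ∈ lowerCylinder js.toFinset <;> simp [hi]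

theorem measure_maxDeviation_lt {n d m b k : ℕ} {M α c t : ℝ} (hα : α ≤ 0.2) (h : m * b ≤ d)
    (hb : 0 < b) (hn : 0 < n) (hk : (k : ℝ) ≤ 37 / 40 * ((n : ℝ) / 2 ^ m)) (hc : 0 < c)
    (ht : 0 ≤ t)
    (hct : c * (t * (41 / 40 * ((n : ℝ) / 2 ^ m))) ≤
      n * (1 - (1 + (1 / 2) ^ m * (Real.cosh (c * M) - 1))⁻¹) - Real.log 2) :
    Measure.pi (fun _ : Fin n => noiseLaw d M)
        {D | maxDeviation (noiseLaw d M) α k D < ENNReal.ofReal t} ≤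
      ENNReal.ofReal ((b : ℝ) ^ m * (m + 1) * (2 * Real.exp (-(n / 2 ^ m / 6400)))) +
      ENNReal.ofReal (4 * (
        Real.exp (n * (2 * (Real.cosh (c * M) - 1) * (1 + (Real.cosh (c * M) - 1))) / 2 ^ m *
          Real.exp (-(m / 4 * Real.log 2))) +
        Real.exp (n * (2 * (Real.cosh (c * M) - 1) * (1 + (Real.cosh (c * M) - 1))) / 2 ^ m +
          m * Real.log 2 - 3 / 4 * m * Real.log b) - 1)) := by
  have ha : 0 ≤ Real.cosh (c * M) - 1 := sub_nonneg.2 (Real.one_le_cosh _)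
  have : Nonempty (Fin m → Fin b) := ⟨fun _ => ⟨0, hb⟩⟩
  set P := Measure.pi (fun _ : Fin n => noiseLaw d M)
  let s : (Fin m → Fin b) → Finset (Fin d) := fun J => (splitSequence h J).toFinset
  have hZ := measure_partitionFunction_lt (n := n) M c s (card_splitSequence h)
    (B := _) (by
      refine (Finset.sum_le_sum fun J _ => sum_one_add_pow_le h hb
        (g := 2 * (Real.cosh (c * M) - 1) * (1 + (Real.cosh (c * M) - 1)))
        (by positivity) J).trans_eq ?_
      rw [Finset.sum_const, nsmul_eq_mul, Finset.card_univ, Fintype.card_fun, Fintype.card_fin,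
        Fintype.card_fin, Nat.cast_pow, ← mul_assoc, ← sq])
  set A : ℝ := 1 + (1 / 2) ^ m * (Real.cosh (c * M) - 1)
  have hA : 0 < A := by positivity
  -- Validity is checked at every split, so all prefixes of lengths `0, …, m` must have good counts.
  let bad : (Fin m → Fin b) × Fin (m + 1) → Set (Fin n → Cube d × ℝ) := fun q =>
    {D | ¬ (39 / 40 * (n / 2 ^ (q.2 : ℕ) : ℝ) ≤ pointCount (fun i => (D i).1)
        (lowerCylinder ((splitSequence h q.1).take q.2).toFinset) ∧
      pointCount (fun i => (D i).1) (lowerCylinder ((splitSequence h q.1).take q.2).toFinset) ≤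
        41 / 40 * (n / 2 ^ (q.2 : ℕ) : ℝ))}
  have hbad : P (⋃ q, bad q) ≤
      ENNReal.ofReal ((b : ℝ) ^ m * (m + 1) * (2 * Real.exp (-(n / 2 ^ m / 6400)))) := by
    refine (measure_iUnion_fintype_le P bad).trans ?_
    have hq : ∀ q, P (bad q) ≤ ENNReal.ofReal (2 * Real.exp (-(n / 2 ^ m / 6400))) := by
      intro q
      have hqm : (q.2 : ℕ) ≤ m := Nat.lt_succ_iff.1 q.2.2
      have := measure_pointCount_not_near (n := n) M ((splitSequence h q.1).take q.2).toFinset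
      rw [card_take_splitSequence h q.1 hqm] at this
      refine this.trans (ENNReal.ofReal_le_ofReal ?_)
      gcongr
      exact one_le_two
    refine (Finset.sum_le_sum fun q _ => hq q).trans ?_
    rw [Finset.sum_const, nsmul_eq_mul,
      ENNReal.ofReal_mul (p := (b : ℝ) ^ m * (m + 1)) (by positivity)]
    gcongr
    rw [Finset.card_univ, Fintype.card_prod, Fintype.card_fun, Fintype.card_fin, Fintype.card_fin,
      Fintype.card_fin, ← ENNReal.ofReal_natCast]
    push_cast
    exact le_rfl
  refine (measure_mono fun D hD => ?_).trans ((measure_union_le _ _).trans (add_le_add hbad hZ))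
  by_contra hDbad
  rw [Set.mem_union, not_or] at hDbad
  obtain ⟨hD1, hD2⟩ := hDbad
  rw [Set.mem_ofPred_eq, not_lt] at hD2
  refine not_lt.2 (?_ : ENNReal.ofReal t ≤ maxDeviation (noiseLaw d M) α k D) hD
  -- The largest term of the partition function is at least the average term.
  obtain ⟨J, -, hJ⟩ : ∃ J ∈ (Finset.univ : Finset (Fin m → Fin b)),
      A ^ n / 2 ≤ ∏ i, tilt c (s J) (D i) := by
    refine Finset.exists_le_of_sum_le Finset.univ_nonempty ?_
    rw [Finset.sum_const, nsmul_eq_mul, Finset.card_univ, ← mul_div_assoc]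
    exact hD2
  refine le_maxDeviation hα (js := splitSequence h J) ?_ ?_ hn ht ?_
  · intro i hi
    rw [length_splitSequence] at hi
    by_contra hnot
    exact hD1 (Set.mem_iUnion.2 ⟨(J, ⟨i, Nat.lt_succ_of_le hi⟩), hnot⟩)
  · rwa [length_splitSequence]
  · rw [length_splitSequence]
    have hJ' : A ^ n / 2 ≤ Real.exp (c *
        ∑ i, (lowerCylinder (splitSequence h J).toFinset).indicator 1 (D i).1 * (D i).2) := by
      rw [Finset.mul_sum, Real.exp_sum]
      simpa only [tilt_eq_exp] using hJ
    have hlog := Real.log_le_log (by positivity) hJ'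
    rw [Real.log_exp, Real.log_div (by positivity) two_ne_zero, Real.log_pow] at hlog
    have hlogA := mul_le_mul_of_nonneg_left (Real.one_sub_inv_le_log_of_pos hA) (Nat.cast_nonneg n)
    refine le_of_mul_le_mul_left ?_ hc
    linarith

/-! ### Asymptotics -/

theorem half_sq_le_cosh_sub_one {x : ℝ} (hx : 0 ≤ x) : x ^ 2 / 2 ≤ Real.cosh x - 1 := by
  have h := Real.cosh_two_mul (x / 2)
  rw [mul_div_cancel₀ x two_ne_zero, Real.cosh_sq] at h
  have h2 := Real.self_le_sinh_iff.2 (show 0 ≤ x / 2 by linarith)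
  nlinarith

theorem cosh_sub_one_le {x : ℝ} (hx : x ^ 2 ≤ 1 / 20) : Real.cosh x - 1 ≤ 1.1 * (x ^ 2 / 2) := by
  have h := Real.cosh_le_exp_half_sq x
  have h2 := exp_sub_one_le_add_sq (u := x ^ 2 / 2)
    (by rw [abs_of_nonneg (by positivity)]; linarith)
  nlinarith [sq_nonneg x]

/-- In use `N = n / 2 ^ m`, `p = 2 ^ (-m)` and `a = cosh x - 1 ≈ x ^ 2 / 2`. The left side is at
most `0.1081 * Q`, while `n * (1 - (1 + p * a)⁻¹)` is at least `0.12 * Q`; for `Q ≥ 540` the gap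
absorbs `log 2`. -/
theorem threshold_le_signal {n N Q k x a p M : ℝ} (hM : 0 < M) (hN : 0 < N) (hQ : 540 ≤ Q)
    (hk : 9 / 10 * N ≤ k) (hx : x = 1 / 2 * √(Q / N)) (hNx : N * x ^ 2 = Q / 4)
    (hpn : p * n = N) (hp0 : 0 ≤ p) (hp1 : p ≤ 1) (ha0 : 0 ≤ a) (ha : a ≤ 1 / 30)
    (hNa : Q / 8 ≤ N * a) :
    x / M * (M / 5 * √(Q / k) * (41 / 40 * N)) ≤ n * (1 - (1 + p * a)⁻¹) - Real.log 2 := by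
  have hx0 : 0 ≤ x := by rw [hx]; positivity
  -- The constant `1.0541` is `√(10/9)` rounded up.
  have hsqrt : √(Q / k) ≤ 1.0541 * √(Q / N) := by
    rw [← Real.sqrt_sq (show (0 : ℝ) ≤ 1.0541 by norm_num), ← Real.sqrt_mul (by positivity)]
    refine Real.sqrt_le_sqrt ?_
    calc Q / k ≤ Q / (9 / 10 * N) :=
          div_le_div_of_nonneg_left (by linarith) (by positivity) hk
      _ = 10 / 9 * (Q / N) := by field_simp
      _ ≤ _ := mul_le_mul_of_nonneg_right (by norm_num) (div_nonneg (by linarith) hN.le)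
  have hlhs : x / M * (M / 5 * √(Q / k) * (41 / 40 * N)) ≤ 1081 / 10000 * Q := by
    have e : x / M * (M / 5 * √(Q / k) * (41 / 40 * N)) = 41 / 200 * (N * x) * √(Q / k) := by
      field_simp
      ring
    have h1 := mul_le_mul_of_nonneg_left hsqrt (show 0 ≤ 41 / 200 * (N * x) by positivity)
    have h2 : √(Q / N) = 2 * x := by rw [hx]; ring
    have h3 : 41 / 200 * (N * x) * (1.0541 * √(Q / N)) = 41 / 200 * 1.0541 * 2 * (N * x ^ 2) := by
      rw [h2]; ring
    rw [e]
    rw [h3, hNx] at h1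
    norm_num at h1 ⊢
    linarith
  have hpa0 : 0 ≤ p * a := mul_nonneg hp0 ha0
  have hpa : p * a ≤ 1 / 30 := (mul_le_of_le_one_left ha0 hp1).trans ha
  have hrhs : 12 / 100 * Q ≤ n * (1 - (1 + p * a)⁻¹) := by
    have e : n * (1 - (1 + p * a)⁻¹) = N * a / (1 + p * a) := by
      rw [← hpn]
      field_simp
      ring
    rw [e, le_div_iff₀ (by positivity)]
    have := mul_le_mul_of_nonneg_left hpa (show 0 ≤ 12 / 100 * Q by linarith)
    linarith
  have := Real.log_two_lt_d9
  linarith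

theorem count_failure_le {B m L l N r : ℝ} {j : ℕ} (hj : (j : ℝ) = m) (hB : 0 < B)
    (hBl : Real.log B ≤ l) (hBl0 : 0 ≤ Real.log B) (hm : m ≤ L) (hL : 0 ≤ L)
    (hLl : L * l ≤ r * L ^ 2) (hN : 6400 * (r * L ^ 2 + 2 * L) ≤ N) :
    B ^ j * (m + 1) * (2 * Real.exp (-(N / 6400))) ≤ 2 * Real.exp (-L) := by
  have h1 : B ^ j ≤ Real.exp (r * L ^ 2) := by
    rw [← Real.exp_log (pow_pos hB j), Real.log_pow, Real.exp_le_exp, hj]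
    exact (mul_le_mul hm hBl hBl0 hL).trans hLl
  have h2 : m + 1 ≤ Real.exp L := by linarith [Real.add_one_le_exp L]
  have h3 : Real.exp (-(N / 6400)) ≤ Real.exp (-(r * L ^ 2 + 2 * L)) := by
    rw [Real.exp_le_exp]; linarith
  have hm0 : 0 ≤ m := hj ▸ Nat.cast_nonneg j
  calc B ^ j * (m + 1) * (2 * Real.exp (-(N / 6400)))
      ≤ Real.exp (r * L ^ 2) * Real.exp L * (2 * Real.exp (-(r * L ^ 2 + 2 * L))) := by
        gcongr
    _ = 2 * (Real.exp (r * L ^ 2) * Real.exp L * Real.exp (-(r * L ^ 2 + 2 * L))) := by ring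
    _ = 2 * Real.exp (-L) := by
        rw [← Real.exp_add, ← Real.exp_add]
        congr 2
        ring

theorem overlap_exponent_le {β m L l r : ℝ} (hβ : β ≤ 3 / 10 * (L * l))
    (hLl : L * l ≤ r * L ^ 2) (hLl0 : 0 ≤ L * l) (hm : L < m + 1) (hL : 10 ≤ L) :
    β * Real.exp (-(m / 4 * Real.log 2)) ≤ 3 / 10 * r * (L ^ 2 * Real.exp (-(L / 10))) := by
  have hl2 := Real.log_two_gt_d9
  have h1 : Real.exp (-(m / 4 * Real.log 2)) ≤ Real.exp (-(L / 10)) := by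
    rw [Real.exp_le_exp]
    nlinarith
  calc _ ≤ 3 / 10 * (L * l) * Real.exp (-(L / 10)) :=
        mul_le_mul hβ h1 (Real.exp_pos _).le (by linarith)
    _ ≤ 3 / 10 * (r * L ^ 2) * Real.exp (-(L / 10)) := by gcongr
    _ = _ := by ring

/-- Since `lb ≥ l / 2`, the gain `3/4 * m * lb` is about `3/8 * L * l`, which beats `3/10 * L * l`.
The thresholds `10` and `54` make the difference cover the lower-order terms. -/
theorem agreement_exponent_le {β m L l lb : ℝ} (hβ : β ≤ 3 / 10 * (L * l)) (hm : m ≤ L)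
    (hm' : L < m + 1) (hL : 10 ≤ L) (hl : 54 ≤ l) (hlb : l / 2 ≤ lb) :
    β + m * Real.log 2 - 3 / 4 * m * lb ≤ -L := by
  have hl2' := Real.log_two_lt_d9
  have hl2 := Real.log_two_gt_d9
  have e1 : m * Real.log 2 ≤ L := by nlinarith
  have e2 : (L - 1) * (l / 2) ≤ m * lb :=
    mul_le_mul (by linarith) hlb (by linarith) (by linarith)
  have e3 : 0 ≤ (L - 10) * (l - 54) := mul_nonneg (by linarith) (by linarith)
  linarith

/-- The tail bound that results from the choice of parameters, as a function of `log n`. -/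
def failureBound (r L : ℝ) : ℝ≥0∞ :=
  ENNReal.ofReal (2 * Real.exp (-L)) +
    ENNReal.ofReal (4 * (Real.exp (3 / 10 * r * (L ^ 2 * Real.exp (-(L / 10)))) + Real.exp (-L) - 1))

theorem measure_maxDeviation_lt_of_large {n d m k : ℕ} {r M α L l : ℝ} (hα : α ≤ 0.2)
    (hM : 0 < M) (hn : 0 < n) (hm : (m : ℝ) ≤ L) (hm' : L < m + 1) (hl : l = Real.log d)
    (hb : 0 < d / m) (hlogb : l / 2 ≤ Real.log (d / m : ℕ)) (hlr : l ≤ r * L) (hl0 : 54 ≤ l)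
    (hL : 10 ≤ L) (hN : Real.exp (3 / 10 * L) ≤ n / 2 ^ m)
    (hexp : 6400 * (r * L ^ 2 + 2 * L) ≤ Real.exp (3 / 10 * L))
    (hk : 9 / 10 * ((n : ℝ) / 2 ^ m) ≤ k) (hk' : (k : ℝ) ≤ 9 / 10 * ((n : ℝ) / 2 ^ m) + 1) :
    Measure.pi (fun _ : Fin n => noiseLaw d M)
        {D | maxDeviation (noiseLaw d M) α k D < ENNReal.ofReal (M / 5 * √(L * l / k))} ≤
      failureBound r L := by
  set N : ℝ := n / 2 ^ m with hNdef
  have hr : 0 < r * L := by linarith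
  have hQ0 : 540 ≤ L * l := by nlinarith
  have hQ1 : L * l ≤ r * L ^ 2 := by nlinarith
  set Q := L * l with hQ
  have hNQ : 6400 * (Q + 20) ≤ N := by linarith
  have hNpos : 0 < N := by linarith
  have hnN : (1 / 2 : ℝ) ^ m * n = N := by rw [hNdef, one_div_pow]; ring
  -- The factor `1/2` is a compromise: the deviation obtained grows with `x`, but `β ≈ N * x ^ 2 = Q
  -- / 4` must stay below `3/8 * Q`.
  set x := 1 / 2 * √(Q / N) with hx
  have hxpos : 0 < x := by
    have : 0 < Q / N := div_pos (by linarith) hNpos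
    positivity
  have hx2 : x ^ 2 = Q / N / 4 := by
    rw [hx, mul_pow, Real.sq_sqrt (div_nonneg (by linarith) hNpos.le)]; ring
  have hNx2 : N * x ^ 2 = Q / 4 := by rw [hx2]; field_simp
  have hx2small : x ^ 2 ≤ 1 / 20 := by
    rw [hx2, div_div, div_le_iff₀ (by linarith)]
    linarith
  have hcM : x / M * M = x := div_mul_cancel₀ x hM.ne'
  have ha_lo := half_sq_le_cosh_sub_one hxpos.le
  have ha_hi := cosh_sub_one_le hx2small
  have hmain := measure_maxDeviation_lt (n := n) (d := d) (m := m) (b := d / m) (k := k) (M := M)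
    (c := x / M) (t := M / 5 * √(Q / k)) hα (Nat.mul_div_le d m) hb hn (by linarith)
    (div_pos hxpos hM) (by positivity)
  rw [hcM] at hmain
  set a := Real.cosh x - 1
  have ha0 : 0 ≤ a := (by positivity : 0 ≤ x ^ 2 / 2).trans ha_lo
  have hNa_lo : Q / 8 ≤ N * a := by nlinarith
  have hNa_hi : N * a ≤ 1.1 * (Q / 8) := by nlinarith
  have ha_small : a ≤ 1 / 30 := by norm_num at ha_hi; linarith
  have hdpos : (0 : ℝ) < (d / m : ℕ) := by exact_mod_cast hb
  have hbl : Real.log (d / m : ℕ) ≤ l := by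
    rw [hl]
    exact Real.log_le_log hdpos (by exact_mod_cast Nat.div_le_self d m)
  have hβ : n * (2 * a * (1 + a)) / 2 ^ m ≤ 3 / 10 * Q := by
    have e : n * (2 * a * (1 + a)) / 2 ^ m = 2 * (N * a) * (1 + a) := by rw [hNdef]; ring
    rw [e]
    have := mul_le_mul hNa_hi (show 1 + a ≤ 31 / 30 by linarith) (by linarith) (by linarith)
    norm_num at this
    linarith
  refine (hmain (threshold_le_signal hM hNpos hQ0 hk hx hNx2 hnN (by positivity)
    (pow_le_one₀ (by norm_num) (by norm_num)) ha0 ha_small hNa_lo)).trans ?_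
  refine add_le_add (ENNReal.ofReal_le_ofReal ?_) (ENNReal.ofReal_le_ofReal ?_)
  · exact count_failure_le rfl hdpos hbl (by linarith) hm (by linarith) hQ1 (hexp.trans hN)
  · have h1 := Real.exp_le_exp.2 (overlap_exponent_le hβ hQ1 (by linarith) hm' hL)
    have h2 := Real.exp_le_exp.2 (agreement_exponent_le hβ hm hm' hL hl0 hlogb)
    linarith

theorem tendsto_failureBound (r : ℝ) : Tendsto (failureBound r) atTop (𝓝 0) := by
  have h1 : Tendsto (fun L : ℝ => Real.exp (-L)) atTop (𝓝 0) :=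
    Real.tendsto_exp_neg_atTop_nhds_zero
  have h2 : Tendsto (fun L : ℝ => L ^ 2 * Real.exp (-(L / 10))) atTop (𝓝 0) := by
    have := (isLittleO_pow_exp_pos_mul_atTop (b := 1 / 10) 2 (by norm_num)).tendsto_div_nhds_zero
    refine this.congr fun L => ?_
    rw [Real.exp_neg, ← div_eq_mul_inv]
    congr 2
    ring
  have h3 : Tendsto (fun L : ℝ => Real.exp (3 / 10 * r * (L ^ 2 * Real.exp (-(L / 10))))) atTop
      (𝓝 1) := by
    have := (Real.continuous_exp.tendsto _).comp (h2.const_mul (3 / 10 * r))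
    simpa [Function.comp_def] using this
  have h4 := ENNReal.tendsto_ofReal (h1.const_mul 2)
  have h5 := ENNReal.tendsto_ofReal (((h3.add h1).sub_const 1).const_mul 4)
  have h6 := h4.add h5
  rw [show ENNReal.ofReal (2 * 0) + ENNReal.ofReal (4 * (1 + 0 - 1)) = 0 by norm_num] at h6
  exact h6

/-- The depth of the chains. -/
def chainDepth (n : ℕ) : ℕ := ⌊Real.log n⌋₊

/-- The minimum leaf size. -/
def leafSize (n : ℕ) : ℕ := ⌊9 / 10 * ((n : ℝ) / 2 ^ chainDepth n)⌋₊ + 1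

theorem le_leafSize (n : ℕ) : 9 / 10 * ((n : ℝ) / 2 ^ chainDepth n) ≤ leafSize n := by
  rw [leafSize]; push_cast; exact (Nat.lt_floor_add_one _).le

theorem leafSize_le (n : ℕ) : (leafSize n : ℝ) ≤ 9 / 10 * ((n : ℝ) / 2 ^ chainDepth n) + 1 := by
  rw [leafSize]; push_cast; gcongr; exact Nat.floor_le (by positivity)

theorem exp_le_div_two_pow_chainDepth {n : ℕ} (hn : 0 < n) :
    Real.exp (3 / 10 * Real.log n) ≤ (n : ℝ) / 2 ^ chainDepth n := by
  have hn' : (1 : ℝ) ≤ n := by exact_mod_cast hn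
  have hL := Real.log_nonneg hn'
  have hm : (chainDepth n : ℝ) ≤ Real.log n := Nat.floor_le hL
  have h2 : (2 : ℝ) ^ chainDepth n = Real.exp (chainDepth n * Real.log 2) := by
    rw [Real.exp_nat_mul, Real.exp_log two_pos]
  rw [le_div_iff₀ (by positivity), h2, ← Real.exp_add]
  conv_rhs => rw [← Real.exp_log (show (0 : ℝ) < n by linarith)]
  rw [Real.exp_le_exp]
  have := Real.log_two_lt_d9
  nlinarith

theorem tendsto_log_natCast : Tendsto (fun n : ℕ => Real.log n) atTop atTop :=
  Real.tendsto_log_atTop.comp tendsto_natCast_atTop_atTop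

theorem log_floor_rpow_le {n : ℕ} (hn : 0 < n) {r : ℝ} (hr : 0 < r) :
    Real.log ⌊(n : ℝ) ^ r⌋₊ ≤ r * Real.log n := by
  have hn' : (1 : ℝ) ≤ n := by exact_mod_cast hn
  have h1 : 1 ≤ (n : ℝ) ^ r := Real.one_le_rpow hn' hr.le
  rw [← Real.log_rpow (by linarith)]
  refine Real.log_le_log ?_ (Nat.floor_le (by linarith))
  exact_mod_cast Nat.floor_pos.2 h1

theorem minimumLeafSize_leafSize {r : ℝ} (hr : 0 < r) :
    MinimumLeafSize (fun n : ℕ => ⌊(n : ℝ) ^ r⌋₊) leafSize := by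
  refine ⟨fun n => Nat.succ_pos _, ?_⟩
  have h0 : Tendsto (fun n : ℕ => (r + 1) * (10 / 9) *
      (Real.log n ^ 2 / Real.exp (3 / 10 * Real.log n))) atTop (𝓝 0) := by
    have := ((isLittleO_pow_exp_pos_mul_atTop (b := 3 / 10) 2
      (by norm_num)).tendsto_div_nhds_zero.comp tendsto_log_natCast).const_mul
        ((r + 1) * (10 / 9))
    simpa using this
  refine squeeze_zero' ?_ ?_ h0
  · filter_upwards [eventually_gt_atTop 0] with n hn
    have hL : 0 ≤ Real.log n := Real.log_natCast_nonneg n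
    have hl : 0 ≤ Real.log (⌊(n : ℝ) ^ r⌋₊ : ℝ) := Real.log_natCast_nonneg _
    have : 0 ≤ max (Real.log (⌊(n : ℝ) ^ r⌋₊ : ℝ)) (Real.log (Real.log n)) := le_max_of_le_left hl
    positivity
  · filter_upwards [eventually_gt_atTop 0] with n hn
    have hL : 0 ≤ Real.log n := Real.log_natCast_nonneg n
    have hmax : max (Real.log (⌊(n : ℝ) ^ r⌋₊ : ℝ)) (Real.log (Real.log n)) ≤
        (r + 1) * Real.log n := by
      refine max_le ?_ ?_
      · linarith [log_floor_rpow_le hn hr]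
      · have := Real.log_le_self hL
        nlinarith
    have hk : 9 / 10 * Real.exp (3 / 10 * Real.log n) ≤ leafSize n :=
      (mul_le_mul_of_nonneg_left (exp_le_div_two_pow_chainDepth hn) (by norm_num)).trans
        (le_leafSize n)
    calc Real.log n * max (Real.log (⌊(n : ℝ) ^ r⌋₊ : ℝ)) (Real.log (Real.log n)) / leafSize n
        ≤ Real.log n * ((r + 1) * Real.log n) / (9 / 10 * Real.exp (3 / 10 * Real.log n)) := by
          gcongr
      _ = _ := by field_simp

/-- The crude bound `√d ≤ ⌊d / m⌋` suffices, at the price of half the logarithm. -/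
theorem half_log_le_log_div {d m : ℕ} (hd : 0 < d) (hm : 0 < m) (h : 2 * (m : ℝ) ≤ √d) :
    0 < d / m ∧ Real.log d / 2 ≤ Real.log (d / m : ℕ) := by
  have hm' : (1 : ℝ) ≤ m := by exact_mod_cast hm
  have hd' : (0 : ℝ) < d := by exact_mod_cast hd
  have hsq : √(d : ℝ) * √d = d := Real.mul_self_sqrt hd'.le
  have hlt : (d : ℝ) < m * ((d / m : ℕ) + 1) := by exact_mod_cast Nat.lt_mul_div_succ d hm
  have hle : √(d : ℝ) ≤ (d / m : ℕ) := by
    by_contra! hcon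
    nlinarith
  have hs : 0 < √(d : ℝ) := Real.sqrt_pos.2 hd'
  refine ⟨by exact_mod_cast hs.trans_le hle, ?_⟩
  rw [← Real.log_sqrt hd'.le]
  exact Real.log_le_log hs hle

theorem tendsto_measure_maxDeviation_lt {r : ℝ} (hr : 0 < r) {α : ℝ} (hα : α ≤ 0.2) {M : ℝ}
    (hM : 0 < M) :
    Tendsto (fun n : ℕ => Measure.pi (fun _ : Fin n => noiseLaw ⌊(n : ℝ) ^ r⌋₊ M)
      {D | maxDeviation (noiseLaw ⌊(n : ℝ) ^ r⌋₊ M) α (leafSize n) D < ENNReal.ofReal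
        (M / 5 * √(Real.log n * Real.log ⌊(n : ℝ) ^ r⌋₊ / (leafSize n : ℝ)))}) atTop (𝓝 0) := by
  have hd : Tendsto (fun n : ℕ => ⌊(n : ℝ) ^ r⌋₊) atTop atTop :=
    tendsto_nat_floor_atTop.comp ((tendsto_rpow_atTop hr).comp tendsto_natCast_atTop_atTop)
  have hdl := tendsto_log_natCast.comp hd
  refine tendsto_of_tendsto_of_tendsto_of_le_of_le' tendsto_const_nhds
    ((tendsto_failureBound r).comp tendsto_log_natCast) (Eventually.of_forall fun _ => zero_le) ?_
  have hexp : ∀ᶠ L : ℝ in atTop, 6400 * (r * L ^ 2 + 2 * L) ≤ Real.exp (3 / 10 * L) := by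
    have h2 := (isLittleO_pow_exp_pos_mul_atTop (b := 3 / 10) 2 (by norm_num)).bound
      (c := (6400 * (r + 2))⁻¹) (by positivity)
    filter_upwards [h2, eventually_ge_atTop 1] with L hL hL1
    rw [Real.norm_of_nonneg (by positivity), Real.norm_of_nonneg (Real.exp_pos _).le,
      inv_mul_eq_div, le_div_iff₀ (by positivity)] at hL
    nlinarith
  -- Once `r * log n ≤ 2 * log d`, this yields `2 * m ≤ 2 * log n ≤ 4 / r * log d ≤ √d`.
  have hroot : ∀ᶠ x : ℝ in atTop, 4 / r * Real.log x ≤ √x := by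
    have h2 := (isLittleO_log_rpow_atTop (r := 1 / 2) (by norm_num)).bound
      (c := r / 4) (by positivity)
    filter_upwards [h2, eventually_ge_atTop 1] with x hx hx1
    rw [Real.norm_of_nonneg (Real.log_nonneg hx1), ← Real.sqrt_eq_rpow,
      Real.norm_of_nonneg (Real.sqrt_nonneg _)] at hx
    rw [div_mul_eq_mul_div, div_le_iff₀ hr]
    linarith
  filter_upwards [eventually_gt_atTop 0, tendsto_log_natCast.eventually hexp,
    tendsto_log_natCast.eventually_ge_atTop 10, hdl.eventually_ge_atTop 54,
    (tendsto_natCast_atTop_atTop.comp hd).eventually hroot, hd.eventually_ge_atTop 2]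
    with n hn hexpn hL hl hrootn hd2
  simp only [Function.comp_apply] at hl hrootn ⊢
  have hlr := log_floor_rpow_le hn hr
  have hn0 : (0 : ℝ) < n := by exact_mod_cast hn
  have hLl : r * Real.log n ≤ 2 * Real.log ⌊(n : ℝ) ^ r⌋₊ := by
    have hd2' : (2 : ℝ) ≤ ⌊(n : ℝ) ^ r⌋₊ := by exact_mod_cast hd2
    -- The floor `d` satisfies `n ^ r ≤ d + 1 ≤ d ^ 2` as soon as `d ≥ 2`.
    have h1 : (n : ℝ) ^ r ≤ (⌊(n : ℝ) ^ r⌋₊ : ℝ) ^ 2 := by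
      have := (Nat.lt_floor_add_one ((n : ℝ) ^ r)).le
      nlinarith
    have := Real.log_le_log (by positivity) h1
    rwa [Real.log_rpow hn0, Real.log_pow] at this
  have hm : (chainDepth n : ℝ) ≤ Real.log n := Nat.floor_le (by linarith)
  have hm' : Real.log n < chainDepth n + 1 := Nat.lt_floor_add_one _
  have hm0 : 0 < chainDepth n := by
    have : (0 : ℝ) < chainDepth n := by linarith
    exact_mod_cast this
  have hLroot : 2 * (chainDepth n : ℝ) ≤ √(⌊(n : ℝ) ^ r⌋₊ : ℝ) := by
    refine le_trans ?_ hrootn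
    rw [div_mul_eq_mul_div, le_div_iff₀ hr]
    nlinarith
  obtain ⟨hb, hlogb⟩ := half_log_le_log_div (by omega) hm0 hLroot
  exact measure_maxDeviation_lt_of_large hα hM hn hm hm' rfl hb hlogb hlr hl hL
    (exp_le_div_two_pow_chainDepth hn) hexpn (le_leafSize n) (leafSize_le n)

end

theorem mainTheorem2 (r : ℝ) (hr : 0 < r) (α : ℝ) (hα0 : 0 < α) (hα : α ≤ 0.2)
    (M : ℝ) (hM : 0 < M) :
    ∃ (ζ : ℝ) (μ : (n : ℕ) → Measure (Cube ⌊(n : ℝ) ^ r⌋₊ × ℝ)) (k : ℕ → ℕ),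
      1 ≤ ζ ∧
      (∀ n : ℕ, IsProbabilityMeasure (μ n)) ∧
      (∀ n : ℕ, WeaklyDependentFeatures ζ (μ n)) ∧
      (∀ n : ℕ, iIndepFun (fun (j : Fin ⌊(n : ℝ) ^ r⌋₊) (p : Cube ⌊(n : ℝ) ^ r⌋₊ × ℝ) => p.1 j)
        (μ n)) ∧
      (∀ n : ℕ, IndepFun Prod.fst Prod.snd (μ n)) ∧
      (∀ n : ℕ, μ n {p | p.2 = M} = 1 / 2 ∧ μ n {p | p.2 = -M} = 1 / 2) ∧
      MinimumLeafSize (fun n : ℕ => ⌊(n : ℝ) ^ r⌋₊) k ∧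
      -- the event has probability tending to one
      Tendsto (fun n : ℕ => Measure.pi (fun _ : Fin n => μ n)
          {D | ENNReal.ofReal
              (M / 5 * √(Real.log n * Real.log ⌊(n : ℝ) ^ r⌋₊ / (k n : ℝ)))
            ≤ maxDeviation (μ n) α (k n) D})
        atTop (𝓝 1) ∧
      -- its complement has outer probability tending to zero: no measurability is presupposed
      Tendsto (fun n : ℕ => Measure.pi (fun _ : Fin n => μ n)
          {D | maxDeviation (μ n) α (k n) D < ENNReal.ofReal
              (M / 5 * √(Real.log n * Real.log ⌊(n : ℝ) ^ r⌋₊ / (k n : ℝ)))})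
        atTop (𝓝 0) := by
  have hlim := tendsto_measure_maxDeviation_lt hr hα hM
  refine ⟨1, fun n => noiseLaw _ M, leafSize, le_rfl, fun n => inferInstance,
    fun n => weaklyDependentFeatures_noiseLaw _ M, fun n => iIndepFun_coordinates_noiseLaw _ M,
    fun n => indepFun_noiseLaw _ M, fun n => noiseLaw_snd_eq _ hM, minimumLeafSize_leafSize hr,
    ?_, hlim⟩
  -- Subadditivity of the outer measure gives `1 - P(complement) ≤ P(event)` without measurability
  -- of either set.
  have hone := ENNReal.Tendsto.sub (tendsto_const_nhds (x := (1 : ℝ≥0∞)) (f := atTop)) hlim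
    (Or.inl ENNReal.one_ne_top)
  rw [tsub_zero] at hone
  refine tendsto_of_tendsto_of_tendsto_of_le_of_le hone tendsto_const_nhds (fun n => ?_)
    fun n => prob_le_one
  rw [tsub_le_iff_right]
  refine le_trans ?_ (measure_union_le _ _)
  refine (measure_univ (μ := Measure.pi fun _ : Fin n => noiseLaw _ M)).symm.le.trans
    (measure_mono fun D _ => ?_)
  exact le_or_gt (ENNReal.ofReal (M / 5 *
    √(Real.log n * Real.log ⌊(n : ℝ) ^ r⌋₊ / (leafSize n : ℝ)))) (maxDeviation (noiseLaw _ M) α _ D)
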